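/- Let $K$ be a field that is complete with respect to a nontrivial non-archimedean absolute value (for example a complete discrete valuation field), let $m\ge 1$, and equip $K^m$ and $M_m(K)$ with the maximum norms of coordinates and of entries. Let $f:K^m\to K^m$ and let $x^\star\in K^m$ be a zero of $f$ at which $f$ is strictly differentiable with invertible Jacobian matrix $f'(x^\star)$. Given $x_0\in K^m$ and $B_0\in M_m(K)$, the (ultrametric) Broyden iterates are defined by $$x_{n+1}=x_n-B_n^{-1}f(x_n),\qquad s_n=x_{n+1}-x_n,\qquad y_n=f(x_{n+1})-f(x_n),$$ $$B_{n+1}=B_n+(y_n-B_ns_n)\,u_n^{t},\qquad u_n=s_{n,l}^{-1}e_l,$$ where $l$ is the smallest index with $|s_{n,l}|=\|s_n\|$; by convention, if $f(x_n)=0$ then $x_{n+1}=x_n$ and $B_{n+1}=B_n$. Assume that there are a neighborhood $U$ of $x^\star$ and a constant $c_0>0$ such that $$\|f(x)-f(y)-f'(x^\star)(x-y)\|\le c_0\|x-y\|^2\qquad\text{for all }x,y\in U.$$ Then there are $\eta,\delta,\Gamma>0$ such that, whenever $\|x_0-x^\star\|<\eta$ and $\|B_0-f'(x^\star)\|<\delta$,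 the Broyden iterates are well defined (every $B_n$ is invertible and every $x_n$ lies in $U$) and $$\|x_{w+2m}-x^\star\|\le\Gamma\,\|x_w-x^\star\|^2\qquad\text{for every integer }w\ge 0 .$$ -/

import Mathlib

open scoped Matrix Topology
open scoped Matrix.Norms.Elementwise

/-- `l` is the smallest index at which the maximum norm of `s` is attained
(equivalently, at which the minimal valuation of the coordinates is attained). -/
def IsPivot {K : Type*} [NormedField K] {m : ℕ} (s : Fin m → K) (l : Fin m) : Prop :=
  ‖s l‖ = ‖s‖ ∧ ∀ i : Fin m, i < l → ‖s i‖ ≠ ‖s‖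

open Classical in
/-- The vector `u = s_l⁻¹ • e_l`, where `l` is the smallest index with `‖s_l‖ = ‖s‖`.
There is exactly one such `l` as soon as the dimension is positive. -/
noncomputable def broydenU {K : Type*} [NormedField K] {m : ℕ} (s : Fin m → K) : Fin m → K :=
  fun j => if IsPivot s j then (s j)⁻¹ else 0

open Classical in
/-- One step of the ultrametric Broyden method, `(x, B) ↦ (x⁺, B⁺)`:
with `s = x⁺ - x` and `y = f x⁺ - f x`,
`x⁺ = x - B⁻¹ f(x)` and `B⁺ = B + (y - B s) uᵗ`, where `u = s_l⁻¹ e_l`.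
By convention the pair is left unchanged when `f x = 0`. -/
noncomputable def broydenStep {K : Type*} [NormedField K] {m : ℕ}
    (f : (Fin m → K) → (Fin m → K)) (p : (Fin m → K) × Matrix (Fin m) (Fin m) K) :
    (Fin m → K) × Matrix (Fin m) (Fin m) K :=
  if f p.1 = 0 then p
  else
    let x' : Fin m → K := p.1 - p.2⁻¹ *ᵥ f p.1
    let s : Fin m → K := x' - p.1
    let y : Fin m → K := f x' - f p.1
    (x', p.2 + Matrix.vecMulVec (y - p.2 *ᵥ s) (broydenU s))

/-- The pairs `(x_n, B_n)` produced by the ultrametric Broyden method from `(x_0, B_0)`. -/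
noncomputable def broyden {K : Type*} [NormedField K] {m : ℕ}
    (f : (Fin m → K) → (Fin m → K)) (x₀ : Fin m → K) (B₀ : Matrix (Fin m) (Fin m) K) :
    ℕ → (Fin m → K) × Matrix (Fin m) (Fin m) K
  | 0 => (x₀, B₀)
  | n + 1 => broydenStep f (broyden f x₀ B₀ n)

/-!
Put `G_n = J⁻¹ B_n - 1`. The ultrametric inequality keeps `‖G_n v‖ ≤ ‖v‖ / 2` and makes the
errors at least halve at each step (`broyden_succ_near`), so that the increment `s_n` has exactly the norm of the error
`x_n - x⋆`. If `f` were affine, one would have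

* `G_{n+1} = G_n (1 - s_n u_nᵗ)`, hence `G_{n+1} s_n = 0`;
* `(1 + G_{n+1}) s_{n+1} = G_n s_n`.

For general `f` and indices `n ≥ w` these relations, applied to vectors of norm at most `‖s_n‖`,
hold up to an error of norm at most `r = Γ ‖x_w - x⋆‖²`. The ball of radius `r` is a module over
the valuation ring `O` and is stable under every `G_n`, so in the quotient of `K ^ m` by this ball
the recursion is that of an affine map, exactly. It remains to see that `s_{w+2m}` vanishes in
this quotient (`norm_increment_le_of_approx`).

There the finite termination argument of Gay for linear systems works over the ring `O`, with
dimensions replaced by degrees of monic annihilating polynomials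
(`linearBroyden_increment_eq_zero`). The choice of the pivot makes the coefficients `u_nᵗ v`
integral for `‖v‖ ≤ ‖s_n‖`, so `G_{n+1}` maps the span `L` of the vectors `G_n ^ i s_n` into
itself. As `G_{n+1}` kills `s_n`, the module `G_{n+1} L` has one generator less than `L`, and it
contains `G_{n+1} s_{n+1}`; Cayley–Hamilton turns the number of generators into the degree of a
monic polynomial in `G_{n+1}` annihilating `G_{n+1} s_{n+1}`. The next step transfers this
polynomial degree to `s_{n+2}`. So the degree, at most `m` at the beginning, drops by one every
two steps, and after `2 m` steps the polynomial is `1`.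
-/

/-! ### Monic polynomials annihilating a vector under an endomorphism -/

section Annihilation

open Polynomial

variable {R V : Type*} [CommRing R] [AddCommGroup V] [Module R V]

/-- Cayley–Hamilton for a stable submodule with `d` generators, which need not be free: the
annihilating monic polynomial may be chosen of degree exactly `d`. -/
theorem exists_monic_aeval_eq_zero_of_span [Nontrivial R] {d : ℕ} (b : Fin d → V)
    (T : Module.End R V) (hT : ∀ j, T (b j) ∈ Submodule.span R (Set.range b)) :
    ∃ q : R[X], q.Monic ∧ q.natDegree = d ∧
      ∀ x ∈ Submodule.span R (Set.range b), aeval T q x = 0 := by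
  have h1 : ∀ j, ∃ c : Fin d → R, ∑ i, c i • b i = T (b j) := fun j =>
    (Submodule.mem_span_range_iff_exists_fun R).1 (hT j)
  choose c hc using h1
  let A : Matrix (Fin d) (Fin d) R := Matrix.of fun i j => c j i
  let φ : (Fin d → R) →ₗ[R] V := Fintype.linearCombination R b
  have hcomm : ∀ v, φ (Matrix.toLin' A v) = T (φ v) := by
    intro v
    have : φ ∘ₗ Matrix.toLin' A = T ∘ₗ φ := by
      refine LinearMap.pi_ext' fun j => LinearMap.ext_ring ?_
      simp [φ, Fintype.linearCombination_apply, A, ← hc, Pi.single_apply]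
    exact LinearMap.congr_fun this v
  have hpow : ∀ (i : ℕ) v, φ ((Matrix.toLin' A ^ i) v) = (T ^ i) (φ v) := by
    intro i
    induction i with
    | zero => intro v; simp
    | succ i ih => intro v; rw [pow_succ, pow_succ, Module.End.mul_apply, ih, hcomm,
        Module.End.mul_apply]
  refine ⟨A.charpoly, A.charpoly_monic, by simp, fun x hx => ?_⟩
  obtain ⟨v, rfl⟩ := (Submodule.mem_span_range_iff_exists_fun R).1 hx
  have hv : ∑ i, v i • b i = φ v := by simp [φ, Fintype.linearCombination_apply]
  have h0 : aeval (Matrix.toLin' A) A.charpoly = 0 := by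
    rw [← Matrix.charpoly_toLin']
    exact LinearMap.aeval_self_charpoly _
  rw [hv, aeval_eq_sum_range, LinearMap.sum_apply]
  rw [aeval_eq_sum_range] at h0
  have h2 := congrArg φ (LinearMap.congr_fun h0 v)
  rw [LinearMap.sum_apply, map_sum] at h2
  simpa [hpow] using h2

theorem pow_apply_mem_span_of_monic [Nontrivial R] {d : ℕ} {p : R[X]} (hp : p.Monic) (hd : p.natDegree = d)
    {T : Module.End R V} {v : V} (h : aeval T p v = 0) (i : ℕ) :
    (T ^ i) v ∈ Submodule.span R (Set.range fun j : Fin d => (T ^ (j : ℕ)) v) := by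
  have key : (T ^ i) v = aeval T (X ^ i %ₘ p) v := by
    have h1 := modByMonic_add_div (X ^ i : R[X]) p
    calc (T ^ i) v = aeval T (X ^ i : R[X]) v := by simp
      _ = aeval T (X ^ i %ₘ p + p * (X ^ i /ₘ p)) v := by rw [h1]
      _ = _ := by rw [mul_comm]; simp [h]
  rw [key]
  by_cases hp1 : p = 1
  · subst hp1; simp
  have hdeg : (X ^ i %ₘ p).natDegree < d := hd ▸ natDegree_modByMonic_lt _ hp hp1
  rw [aeval_eq_sum_range' hdeg, LinearMap.sum_apply]
  refine Submodule.sum_mem _ fun j hj => ?_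
  exact Submodule.smul_mem _ _ (Submodule.subset_span ⟨⟨j, Finset.mem_range.1 hj⟩, rfl⟩)

/-! ### The exact linear Broyden recursion -/

/-- One step of the Broyden recursion for a linear system, over an arbitrary ring: `T` and `T'`
stand for `J⁻¹ B - 1` before and after the update, `s` and `s'` for the two consecutive
increments. The rank one update is recorded only on the vectors `T ^ i s`, the only ones on which
its coefficient is integral. -/
structure IsLinearBroydenStep (T T' : Module.End R V) (s s' : V) : Prop where
  update : ∀ i : ℕ, ∃ c : R, T' ((T ^ i) s) = (T ^ (i + 1)) s - c • T s
  secant : T' s = 0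
  step : s' + T' s' = T s
  nilpotent : ∃ N : ℕ, (T' ^ N) s' = 0

namespace IsLinearBroydenStep

variable {T T' : Module.End R V} {s s' : V}

/-- The Neumann series of `(1 + T')⁻¹` is finite at `s'`, so solving `s' + T' s' = T s` does not
leave a stable submodule. -/
theorem increment_mem (h : IsLinearBroydenStep T T' s s') {N : Submodule R V}
    (hN : ∀ x ∈ N, T' x ∈ N) (hs : T s ∈ N) : s' ∈ N := by
  obtain ⟨n, hn⟩ := h.nilpotent
  have key : ∀ i : ℕ, s' - (-1 : R) ^ i • (T' ^ i) s' ∈ N := by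
    intro i
    induction i with
    | zero => simp
    | succ i ih =>
      have e : s' - (-1 : R) ^ (i + 1) • (T' ^ (i + 1)) s'
          = T s - T' (s' - (-1 : R) ^ i • (T' ^ i) s') := by
        rw [← h.step, pow_succ' T', Module.End.mul_apply, map_sub, map_smul, pow_succ]
        module
      rw [e]
      exact N.sub_mem hs (hN _ ih)
  simpa [hn] using key n

/-- The span of the `T ^ i s` is stable under `T'`, which kills its generator `s`; so its image
under `T'` needs one generator less. -/
theorem exists_monic_apply_increment [Nontrivial R] (h : IsLinearBroydenStep T T' s s') {d : ℕ}
    (hs : ∃ p : R[X], p.Monic ∧ p.natDegree = d + 1 ∧ aeval T p s = 0) :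
    ∃ q : R[X], q.Monic ∧ q.natDegree = d ∧ aeval T' q (T' s') = 0 := by
  obtain ⟨p, hp, hd, hps⟩ := hs
  have hL := pow_apply_mem_span_of_monic hp hd hps
  set L := Submodule.span R (Set.range fun j : Fin (d + 1) => (T ^ (j : ℕ)) s)
  have hTs : T s ∈ L := by simpa using hL 1
  have hT'L : ∀ x ∈ L, T' x ∈ L := by
    have : L ≤ L.comap T' := by
      refine Submodule.span_le.2 ?_
      rintro _ ⟨j, rfl⟩
      obtain ⟨c, hc⟩ := h.update j
      change T' ((T ^ (j : ℕ)) s) ∈ L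
      rw [hc]
      exact L.sub_mem (hL _) (L.smul_mem _ hTs)
    exact this
  let b : Fin d → V := fun j => T' ((T ^ ((j : ℕ) + 1)) s)
  have hW : ∀ x ∈ L, T' x ∈ Submodule.span R (Set.range b) := by
    have : L ≤ (Submodule.span R (Set.range b)).comap T' := by
      refine Submodule.span_le.2 ?_
      rintro _ ⟨j, rfl⟩
      change T' ((T ^ (j : ℕ)) s) ∈ Submodule.span R (Set.range b)
      refine Fin.cases ?_ (fun j => ?_) j
      · simp [h.secant]
      · exact Submodule.subset_span ⟨j, by simp [b]⟩
    exact this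
  obtain ⟨q, hq, hqd, hq0⟩ := exists_monic_aeval_eq_zero_of_span b T'
    fun j => hW _ (hT'L _ (hL _))
  exact ⟨q, hq, hqd, hq0 _ (hW _ (h.increment_mem hT'L hTs))⟩

/-- The increment `s'` lies in the span of the `T ^ (i + 1) s`, which is stable under `T'`, so the
degree of an annihilating polynomial passes from `T s` to `s'`. -/
theorem exists_monic_increment [Nontrivial R] (h : IsLinearBroydenStep T T' s s') {d : ℕ}
    (hs : ∃ p : R[X], p.Monic ∧ p.natDegree = d ∧ aeval T p (T s) = 0) :
    ∃ q : R[X], q.Monic ∧ q.natDegree = d ∧ aeval T' q s' = 0 := by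
  obtain ⟨p, hp, hd, hps⟩ := hs
  let b : Fin d → V := fun j => (T ^ (j : ℕ)) (T s)
  have hW : ∀ i : ℕ, (T ^ i) (T s) ∈ Submodule.span R (Set.range b) :=
    pow_apply_mem_span_of_monic hp hd hps
  have hb : ∀ j, T' (b j) ∈ Submodule.span R (Set.range b) := by
    intro j
    obtain ⟨c, hc⟩ := h.update (j + 1)
    have e : b j = (T ^ ((j : ℕ) + 1)) s := by
      rw [pow_succ, Module.End.mul_apply]
    rw [e, hc, pow_succ, Module.End.mul_apply]
    exact Submodule.sub_mem _ (hW _) (Submodule.smul_mem _ _ (by simpa using hW 0))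
  obtain ⟨q, hq, hqd, hq0⟩ := exists_monic_aeval_eq_zero_of_span b T' hb
  refine ⟨q, hq, hqd, hq0 _ (h.increment_mem ?_ (by simpa using hW 0))⟩
  have : Submodule.span R (Set.range b) ≤ (Submodule.span R (Set.range b)).comap T' := by
    refine Submodule.span_le.2 ?_
    rintro _ ⟨j, rfl⟩
    exact hb j
  exact this

end IsLinearBroydenStep

/-- Finite termination of the linear Broyden recursion: two steps lower by one the degree of a
monic polynomial annihilating the increment, until the polynomial is `1`. -/
theorem linearBroyden_increment_eq_zero [Nontrivial R] {T : ℕ → Module.End R V} {s : ℕ → V}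
    (h : ∀ n, IsLinearBroydenStep (T n) (T (n + 1)) (s n) (s (n + 1))) {m : ℕ}
    (h0 : ∃ p : R[X], p.Monic ∧ p.natDegree = m ∧ aeval (T 0) p (s 0) = 0) :
    s (2 * m) = 0 := by
  have key : ∀ j d, j + d = m →
      ∃ p : R[X], p.Monic ∧ p.natDegree = d ∧ aeval (T (2 * j)) p (s (2 * j)) = 0 := by
    intro j
    induction j with
    | zero => rintro d hd; obtain rfl : d = m := by omega
              exact h0
    | succ j ih =>
      intro d hd
      exact (h (2 * j + 1)).exists_monic_increment
        ((h (2 * j)).exists_monic_apply_increment (ih (d + 1) (by omega)))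
  obtain ⟨p, hp, hd, hps⟩ := key m 0 rfl
  rw [hp.natDegree_eq_zero.1 hd] at hps
  simpa using hps

end Annihilation

/-! ### Ultrametric estimates for matrices and for the Broyden vector -/

section Ultrametric

variable {K : Type*} [NormedField K] {m : ℕ}

theorem ultrametric_norm_add_le [IsUltrametricDist K] {v w : Fin m → K} {r : ℝ} (hv : ‖v‖ ≤ r)
    (hw : ‖w‖ ≤ r) : ‖v + w‖ ≤ r :=
  (IsUltrametricDist.norm_add_le_max v w).trans (max_le hv hw)

theorem ultrametric_norm_sub_le [IsUltrametricDist K] {v w : Fin m → K} {r : ℝ} (hv : ‖v‖ ≤ r)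
    (hw : ‖w‖ ≤ r) : ‖v - w‖ ≤ r := by
  rw [sub_eq_add_neg]
  exact ultrametric_norm_add_le hv (by rwa [norm_neg])

theorem norm_mulVec_le_mul [IsUltrametricDist K] (A : Matrix (Fin m) (Fin m) K)
    (v : Fin m → K) : ‖A *ᵥ v‖ ≤ ‖A‖ * ‖v‖ := by
  refine (pi_norm_le_iff_of_nonneg (by positivity)).2 fun i => ?_
  change ‖∑ j, A i j * v j‖ ≤ _
  refine IsUltrametricDist.norm_sum_le_of_forall_le_of_nonneg
    (mul_nonneg (norm_nonneg A) (norm_nonneg v)) fun j _ => ?_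
  rw [norm_mul]
  exact mul_le_mul (Matrix.norm_entry_le_entrywise_sup_norm A) (norm_le_pi_norm v j)
    (norm_nonneg _) (norm_nonneg _)

theorem exists_isPivot (hm : 1 ≤ m) (s : Fin m → K) : ∃ l, IsPivot s l := by
  have : Nonempty (Fin m) := ⟨⟨0, hm⟩⟩
  have hne : {i | ‖s i‖ = ‖s‖}.Nonempty := by
    obtain ⟨i, hi⟩ := Finite.exists_max fun i => ‖s i‖
    exact ⟨i, le_antisymm (norm_le_pi_norm s i)
      ((pi_norm_le_iff_of_nonneg (norm_nonneg _)).2 hi)⟩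
  obtain ⟨l, hl, hmin⟩ := wellFounded_lt.has_min _ hne
  exact ⟨l, hl, fun i hi h => hmin i h hi⟩

theorem broydenU_eq_single {s : Fin m → K} {l : Fin m} (hl : IsPivot s l) :
    broydenU s = Pi.single l (s l)⁻¹ := by
  ext j
  rcases lt_trichotomy j l with h | rfl | h
  · have : ¬ IsPivot s j := fun hj => hl.2 j h hj.1
    simp [broydenU, this, h.ne]
  · simp [broydenU, hl]
  · have : ¬ IsPivot s j := fun hj => hj.2 l h hl.1
    simp [broydenU, this, h.ne']

theorem norm_broydenU_apply_le (hm : 1 ≤ m) (s : Fin m → K) (j : Fin m) :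
    ‖broydenU s j‖ ≤ ‖s‖⁻¹ := by
  obtain ⟨l, hl⟩ := exists_isPivot hm s
  rw [broydenU_eq_single hl, ← hl.1, ← norm_inv]
  by_cases h : j = l
  · subst h; simp
  · simp [h]

theorem norm_broydenU_dotProduct_le_one (hm : 1 ≤ m) {s v : Fin m → K} (hv : ‖v‖ ≤ ‖s‖) :
    ‖broydenU s ⬝ᵥ v‖ ≤ 1 := by
  obtain ⟨l, hl⟩ := exists_isPivot hm s
  rw [broydenU_eq_single hl, single_dotProduct, norm_mul, norm_inv, hl.1, mul_comm,
    ← div_eq_mul_inv]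
  exact div_le_one_of_le₀ ((norm_le_pi_norm v l).trans hv) (norm_nonneg _)

theorem broydenU_dotProduct_self (hm : 1 ≤ m) {s : Fin m → K} (hs : s ≠ 0) :
    broydenU s ⬝ᵥ s = 1 := by
  obtain ⟨l, hl⟩ := exists_isPivot hm s
  rw [broydenU_eq_single hl, single_dotProduct]
  refine inv_mul_cancel₀ fun h => hs ?_
  rw [← norm_eq_zero, ← hl.1, h, norm_zero]

end Ultrametric

/-! ### The linear recursion up to a small error -/

section Approximate

variable {K : Type*} [NormedField K] [IsUltrametricDist K] {m : ℕ}

/-- The closed ball of radius `r` in `K ^ m`, as a module over the valuation ring of `K`. -/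
def ballSubmodule (m : ℕ) (r : ℝ) (hr : 0 ≤ r) :
    Submodule (NormedField.valuation (K := K)).integer (Fin m → K) where
  carrier := {v | ‖v‖ ≤ r}
  add_mem' := ultrametric_norm_add_le
  zero_mem' := by simpa using hr
  smul_mem' := by
    rintro ⟨c, hc⟩ v hv
    have hc' : ‖c‖ ≤ 1 := hc
    change ‖c • v‖ ≤ r
    rw [norm_smul]
    exact (mul_le_of_le_one_left (norm_nonneg _) hc').trans hv

/-- Vectors whose norm is at most that of the scalar `a` are integral combinations of the
vectors `a • e_j`. -/
theorem mem_span_smul_single {a : K} {v : Fin m → K} (hv : ‖v‖ ≤ ‖a‖) :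
    v ∈ Submodule.span (NormedField.valuation (K := K)).integer
      (Set.range fun j : Fin m => a • (Pi.single j 1 : Fin m → K)) := by
  rw [Submodule.mem_span_range_iff_exists_fun]
  have hle : ∀ j, ‖v j / a‖ ≤ 1 := fun j => by
    rw [norm_div]
    exact div_le_one_of_le₀ ((norm_le_pi_norm v j).trans hv) (norm_nonneg _)
  refine ⟨fun j => ⟨v j / a, hle j⟩, ?_⟩
  ext i
  have hi : v i / a * a = v i := by
    by_cases ha : a = 0
    · have : v = 0 := by simpa [ha] using hv
      simp [this]
    · exact div_mul_cancel₀ _ ha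
  simp only [Finset.sum_apply, Pi.smul_apply, Pi.single_apply]
  rw [Finset.sum_eq_single i]
  · simpa [Subring.smul_def] using hi
  · intro j _ hj
    simp [hj.symm]
  · simp

/-- If the relations of the linear Broyden recursion hold up to errors of norm at most `r`, then
`2 m` steps bring the increment into the ball of radius `r`: modulo that ball the recursion is
exact. -/
theorem norm_increment_le_of_approx (hm : 1 ≤ m) {r : ℝ} (hr : 0 < r)
    (A : ℕ → Matrix (Fin m) (Fin m) K) (s : ℕ → Fin m → K)
    (hA : ∀ n v, ‖A n *ᵥ v‖ ≤ 1 / 2 * ‖v‖)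
    (hupd : ∀ n v, ‖v‖ ≤ ‖s n‖ → ∃ c : K, ‖c‖ ≤ 1 ∧
      ‖A (n + 1) *ᵥ v - (A n *ᵥ v - c • (A n *ᵥ s n))‖ ≤ r)
    (hsec : ∀ n, ‖A (n + 1) *ᵥ s n‖ ≤ r)
    (hstep : ∀ n, ‖s (n + 1) + A (n + 1) *ᵥ s (n + 1) - A n *ᵥ s n‖ ≤ r) :
    ‖s (2 * m)‖ ≤ r := by
  let Λ := ballSubmodule (K := K) m r hr.le
  have hΛ : ∀ v : Fin m → K, (Submodule.Quotient.mk v : (Fin m → K) ⧸ Λ) = 0 ↔ ‖v‖ ≤ r :=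
    fun v => Submodule.Quotient.mk_eq_zero Λ
  have hcontr : ∀ n v, ‖A n *ᵥ v‖ ≤ ‖v‖ := fun n v =>
    (hA n v).trans (by linarith [norm_nonneg v])
  let T : ℕ → Module.End (NormedField.valuation (K := K)).integer ((Fin m → K) ⧸ Λ) := fun n =>
    Λ.mapQ Λ ((Matrix.mulVecLin (A n)).restrictScalars _) fun v hv => (hcontr n v).trans hv
  let P : ℕ → ℕ → (Fin m → K) → (Fin m → K) := fun n i v => (fun w => A n *ᵥ w)^[i] v
  have hT : ∀ n v, T n (Submodule.Quotient.mk v) = Submodule.Quotient.mk (A n *ᵥ v) :=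
    fun n v => rfl
  have hP : ∀ n i v, (T n ^ i) (Submodule.Quotient.mk v) = Submodule.Quotient.mk (P n i v) := by
    intro n i v
    induction i with
    | zero => rfl
    | succ i ih => rw [pow_succ', Module.End.mul_apply, ih, hT]
                   simp only [P, Function.iterate_succ_apply']
  have hPn : ∀ n i v, ‖P n i v‖ ≤ (1 / 2) ^ i * ‖v‖ := by
    intro n i v
    induction i with
    | zero => simp [P]
    | succ i ih =>
      have : P n (i + 1) v = A n *ᵥ P n i v := Function.iterate_succ_apply' _ _ _
      rw [this, pow_succ']
      linarith [hA n (P n i v)]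
  have hPle : ∀ n i v, ‖P n i v‖ ≤ ‖v‖ := fun n i v =>
    (hPn n i v).trans (mul_le_of_le_one_left (norm_nonneg _) (pow_le_one₀ (by norm_num)
      (by norm_num)))
  have hlin : ∀ n, IsLinearBroydenStep (T n) (T (n + 1))
      (Submodule.Quotient.mk (s n)) (Submodule.Quotient.mk (s (n + 1))) := by
    intro n
    refine ⟨fun i => ?_, ?_, ?_, ?_⟩
    · obtain ⟨c, hc, hle⟩ := hupd n (P n i (s n)) (hPle _ _ _)
      refine ⟨⟨c, hc⟩, ?_⟩
      rw [pow_succ', Module.End.mul_apply, hP, hT, hT, hT, ← sub_eq_zero,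
        ← Submodule.Quotient.mk_smul, ← Submodule.Quotient.mk_sub, ← Submodule.Quotient.mk_sub,
        hΛ]
      exact hle
    · rw [hT, hΛ]
      exact hsec n
    · rw [hT, hT, ← sub_eq_zero, ← Submodule.Quotient.mk_add, ← Submodule.Quotient.mk_sub, hΛ]
      exact hstep n
    · have hlim : Filter.Tendsto (fun N : ℕ => (1 / 2 : ℝ) ^ N * ‖s (n + 1)‖) Filter.atTop
          (𝓝 (0 * ‖s (n + 1)‖)) :=
        (tendsto_pow_atTop_nhds_zero_of_lt_one (by norm_num) (by norm_num)).mul_const _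
      rw [zero_mul] at hlim
      obtain ⟨N, hN⟩ := (hlim.eventually_lt_const hr).exists
      exact ⟨N, by rw [hP, hΛ]; exact (hPn _ _ _).trans hN.le⟩
  -- The `m` vectors `s₀ₗ • e_j` span all vectors of norm at most `‖s 0‖`, a submodule that
  -- contains `s 0` and is stable under `A 0`; this gives a polynomial of degree `m` to start with.
  obtain ⟨l, hl⟩ := exists_isPivot hm (s 0)
  have hspan : ∀ v : Fin m → K, ‖v‖ ≤ ‖s 0 l‖ → (Submodule.Quotient.mk v : (Fin m → K) ⧸ Λ) ∈
      Submodule.span (NormedField.valuation (K := K)).integer (Set.range fun j : Fin m =>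
        (Submodule.Quotient.mk (s 0 l • (Pi.single j 1 : Fin m → K)) : (Fin m → K) ⧸ Λ)) := by
    intro v hv
    have h1 := Submodule.mem_map_of_mem (f := Λ.mkQ) (mem_span_smul_single hv)
    rw [Submodule.map_span, ← Set.range_comp] at h1
    exact h1
  obtain ⟨q, hq, hqd, hq0⟩ := exists_monic_aeval_eq_zero_of_span _ (T 0) fun j : Fin m =>
    hspan (A 0 *ᵥ (s 0 l • (Pi.single j 1 : Fin m → K))) ((hcontr _ _).trans (by
      rw [norm_smul]
      refine mul_le_of_le_one_right (norm_nonneg _)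
        ((pi_norm_le_iff_of_nonneg zero_le_one).2 fun i => ?_)
      by_cases h : i = j
      · subst h; simp
      · simp [h]))
  exact (hΛ _).1 (linearBroyden_increment_eq_zero hlin ⟨q, hq, hqd, hq0 _ (hspan _ hl.1.ge)⟩)

end Approximate

/-! ### Local behaviour of the Broyden iterates -/

section Local

variable {K : Type*} [NormedField K] {m : ℕ}

/-- If `B` is invertible, the correction `y - B s` of a Broyden step is the new residual, because
`B s = - f x`. This also covers the convention for `f x = 0`, where nothing changes. -/
theorem broyden_succ_of_isUnit (f : (Fin m → K) → (Fin m → K)) (x₀ : Fin m → K)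
    (B₀ : Matrix (Fin m) (Fin m) K) (n : ℕ) (hB : IsUnit (broyden f x₀ B₀ n).2) :
    (broyden f x₀ B₀ n).2 *ᵥ ((broyden f x₀ B₀ (n + 1)).1 - (broyden f x₀ B₀ n).1)
        = -f (broyden f x₀ B₀ n).1 ∧
      (broyden f x₀ B₀ (n + 1)).2 = (broyden f x₀ B₀ n).2 +
        Matrix.vecMulVec (f (broyden f x₀ B₀ (n + 1)).1)
          (broydenU ((broyden f x₀ B₀ (n + 1)).1 - (broyden f x₀ B₀ n).1)) := by
  change _ *ᵥ ((broydenStep f (broyden f x₀ B₀ n)).1 - _) = _ ∧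
    (broydenStep f (broyden f x₀ B₀ n)).2 = _ + Matrix.vecMulVec
      (f (broydenStep f (broyden f x₀ B₀ n)).1)
      (broydenU ((broydenStep f (broyden f x₀ B₀ n)).1 - _))
  generalize broyden f x₀ B₀ n = p at hB ⊢
  by_cases h : f p.1 = 0
  · simp [broydenStep, h]
  · have hs : p.2 *ᵥ (p.1 - p.2⁻¹ *ᵥ f p.1 - p.1) = -f p.1 := by
      rw [sub_sub_cancel_left, Matrix.mulVec_neg, Matrix.mulVec_mulVec,
        Matrix.mul_nonsing_inv _ ((Matrix.isUnit_iff_isUnit_det _).1 hB), Matrix.one_mulVec]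
    simp only [broydenStep, h, if_false]
    refine ⟨hs, ?_⟩
    rw [hs, sub_neg_eq_add, sub_add_cancel]

variable [IsUltrametricDist K] {J : Matrix (Fin m) (Fin m) K} {δ : ℝ}

theorem norm_inv_mulVec_sub_le (hδ : ‖J⁻¹‖ * δ ≤ 1 / 2) {B : Matrix (Fin m) (Fin m) K}
    (hB : ‖B - J‖ ≤ δ) (v : Fin m → K) : ‖(J⁻¹ * (B - J)) *ᵥ v‖ ≤ 1 / 2 * ‖v‖ := by
  rw [← Matrix.mulVec_mulVec]
  calc ‖J⁻¹ *ᵥ ((B - J) *ᵥ v)‖ ≤ ‖J⁻¹‖ * (‖B - J‖ * ‖v‖) :=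
        (norm_mulVec_le_mul _ _).trans (by gcongr; exact norm_mulVec_le_mul _ _)
    _ ≤ ‖J⁻¹‖ * (δ * ‖v‖) := by gcongr
    _ = ‖J⁻¹‖ * δ * ‖v‖ := by ring
    _ ≤ _ := by gcongr

theorem norm_le_norm_inv_mul (hJ : IsUnit J) (hδ : ‖J⁻¹‖ * δ ≤ 1 / 2)
    {B : Matrix (Fin m) (Fin m) K} (hB : ‖B - J‖ ≤ δ) (v : Fin m → K) :
    ‖v‖ ≤ ‖J⁻¹‖ * ‖B *ᵥ v‖ := by
  have e : v = J⁻¹ *ᵥ (B *ᵥ v) - (J⁻¹ * (B - J)) *ᵥ v := by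
    rw [mul_sub, Matrix.nonsing_inv_mul _ ((Matrix.isUnit_iff_isUnit_det _).1 hJ),
      Matrix.sub_mulVec, Matrix.mulVec_mulVec, Matrix.one_mulVec, sub_sub_cancel]
  by_contra! hlt
  have hpos : 0 < ‖v‖ := lt_of_le_of_lt (by positivity) hlt
  have h1 := (norm_mulVec_le_mul J⁻¹ (B *ᵥ v))
  have h2 := norm_inv_mulVec_sub_le hδ hB v
  have h3 : ‖v‖ ≤ max ‖J⁻¹ *ᵥ (B *ᵥ v)‖ ‖(J⁻¹ * (B - J)) *ᵥ v‖ := by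
    conv_lhs => rw [e]
    exact ultrametric_norm_sub_le (le_max_left _ _) (le_max_right _ _)
  rcases le_max_iff.1 h3 with h | h <;> linarith

theorem isUnit_of_norm_sub_le (hJ : IsUnit J) (hδ : ‖J⁻¹‖ * δ ≤ 1 / 2)
    {B : Matrix (Fin m) (Fin m) K} (hB : ‖B - J‖ ≤ δ) : IsUnit B := by
  rw [← Matrix.mulVec_injective_iff_isUnit]
  intro v w hvw
  have h := norm_le_norm_inv_mul hJ hδ hB (v - w)
  rw [Matrix.mulVec_sub, hvw, sub_self, norm_zero, mul_zero] at h
  exact sub_eq_zero.1 (norm_le_zero_iff.1 h)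

variable {f : (Fin m → K) → (Fin m → K)} {xs : Fin m → K} {c η : ℝ}

/-- Bounded deterioration holds here without any loss: since the norm is ultrametric, a Broyden
step that at least halves the error leaves `B` in the same ball around `J`. -/
theorem broyden_succ_near (hm : 1 ≤ m) (hJ : IsUnit J) (hzero : f xs = 0) (hc : 0 < c)
    (hδ : ‖J⁻¹‖ * δ ≤ 1 / 2) (hη : c * η ≤ δ)
    (hquad : ∀ x y, ‖x - xs‖ < η → ‖y - xs‖ < η →
      ‖f x - f y - J *ᵥ (x - y)‖ ≤ c * ‖x - y‖ ^ 2)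
    (x₀ : Fin m → K) (B₀ : Matrix (Fin m) (Fin m) K) (n : ℕ)
    (hx : ‖(broyden f x₀ B₀ n).1 - xs‖ < η) (hB : ‖(broyden f x₀ B₀ n).2 - J‖ ≤ δ) :
    ‖(broyden f x₀ B₀ (n + 1)).1 - xs‖ ≤ 1 / 2 * ‖(broyden f x₀ B₀ n).1 - xs‖ ∧
      ‖(broyden f x₀ B₀ (n + 1)).2 - J‖ ≤ δ := by
  obtain ⟨hs, hB'⟩ := broyden_succ_of_isUnit f x₀ B₀ n (isUnit_of_norm_sub_le hJ hδ hB)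
  rw [hB']
  generalize (broyden f x₀ B₀ (n + 1)).1 = x' at *
  generalize (broyden f x₀ B₀ n).1 = x at *
  generalize (broyden f x₀ B₀ n).2 = B at *
  have hη0 : 0 < η := (norm_nonneg _).trans_lt hx
  have hδ0 : 0 ≤ δ := (norm_nonneg _).trans hB
  -- Within the ball, the Taylor error is dominated by the error of the approximate Jacobian.
  have habsorb : ∀ v : Fin m → K, ‖v‖ < η → c * ‖v‖ ^ 2 ≤ δ * ‖v‖ := by
    intro v hv
    have : c * ‖v‖ ≤ δ := (mul_le_mul_of_nonneg_left hv.le hc.le).trans hη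
    nlinarith [norm_nonneg v]
  have hBJ : ∀ v, ‖(B - J) *ᵥ v‖ ≤ δ * ‖v‖ := fun v =>
    (norm_mulVec_le_mul _ _).trans (by gcongr)
  have herr : ‖x' - xs‖ ≤ 1 / 2 * ‖x - xs‖ := by
    have e : B *ᵥ (x' - xs) = (B - J) *ᵥ (x - xs) - (f x - f xs - J *ᵥ (x - xs)) := by
      rw [← sub_add_sub_cancel x' x xs, Matrix.mulVec_add, hs, hzero, Matrix.sub_mulVec]
      abel
    have h1 : ‖B *ᵥ (x' - xs)‖ ≤ δ * ‖x - xs‖ := by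
      rw [e]
      exact ultrametric_norm_sub_le (hBJ _)
        ((hquad x xs hx (by simpa using hη0)).trans (habsorb _ hx))
    calc ‖x' - xs‖ ≤ ‖J⁻¹‖ * (δ * ‖x - xs‖) :=
          (norm_le_norm_inv_mul hJ hδ hB _).trans (by gcongr)
      _ = ‖J⁻¹‖ * δ * ‖x - xs‖ := by ring
      _ ≤ _ := by gcongr
  refine ⟨herr, ?_⟩
  have hx' : ‖x' - xs‖ < η := by linarith [norm_nonneg (x - xs)]
  have hsη : ‖x' - x‖ < η := by
    rw [← sub_sub_sub_cancel_right x' x xs]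
    refine (ultrametric_norm_sub_le (le_max_left _ _) (le_max_right _ _)).trans_lt (max_lt hx' hx)
  have hf : ‖f x'‖ ≤ δ * ‖x' - x‖ := by
    have e : f x' = (f x' - f x - J *ᵥ (x' - x)) - (B - J) *ᵥ (x' - x) := by
      rw [Matrix.sub_mulVec, hs]
      abel
    rw [e]
    exact ultrametric_norm_sub_le ((hquad x' x hx' hx).trans (habsorb _ hsη)) (hBJ _)
  refine (Matrix.norm_le_iff hδ0).2 fun i j => ?_
  rw [add_sub_right_comm, Matrix.add_apply, Matrix.vecMulVec_apply]
  refine (IsUltrametricDist.norm_add_le_max _ _).trans (max_le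
    ((Matrix.norm_entry_le_entrywise_sup_norm _).trans hB) ?_)
  rw [norm_mul]
  calc ‖f x' i‖ * ‖broydenU (x' - x) j‖ ≤ δ * ‖x' - x‖ * ‖x' - x‖⁻¹ := by
        gcongr
        · exact (norm_le_pi_norm _ i).trans hf
        · exact norm_broydenU_apply_le hm _ j
    _ = δ * (‖x' - x‖ * ‖x' - x‖⁻¹) := by ring
    _ ≤ δ := mul_le_of_le_one_right hδ0 mul_inv_le_one

theorem broyden_near (hm : 1 ≤ m) (hJ : IsUnit J) (hzero : f xs = 0) (hc : 0 < c)
    (hδ : ‖J⁻¹‖ * δ ≤ 1 / 2) (hη : c * η ≤ δ)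
    (hquad : ∀ x y, ‖x - xs‖ < η → ‖y - xs‖ < η →
      ‖f x - f y - J *ᵥ (x - y)‖ ≤ c * ‖x - y‖ ^ 2)
    {x₀ : Fin m → K} {B₀ : Matrix (Fin m) (Fin m) K} (hx : ‖x₀ - xs‖ < η) (hB : ‖B₀ - J‖ ≤ δ)
    (n : ℕ) : ‖(broyden f x₀ B₀ n).1 - xs‖ < η ∧ ‖(broyden f x₀ B₀ n).2 - J‖ ≤ δ := by
  induction n with
  | zero => exact ⟨hx, hB⟩
  | succ n ih =>
    obtain ⟨h1, h2⟩ := broyden_succ_near hm hJ hzero hc hδ hη hquad x₀ B₀ n ih.1 ih.2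
    exact ⟨by linarith [norm_nonneg ((broyden f x₀ B₀ n).1 - xs), ih.1], h2⟩

end Local

/-! ### Quadratic convergence in `2 m` steps -/

theorem theorem3 {K : Type*} [NontriviallyNormedField K] [IsUltrametricDist K] [CompleteSpace K]
    (m : ℕ) (hm : 1 ≤ m)
    (f : (Fin m → K) → (Fin m → K)) (xs : Fin m → K) (J : Matrix (Fin m) (Fin m) K)
    (hzero : f xs = 0)
    (hderiv : HasStrictFDerivAt f (LinearMap.toContinuousLinearMap (Matrix.toLin' J)) xs)
    (hJ : IsUnit J)
    (U : Set (Fin m → K)) (hU : U ∈ 𝓝 xs) (c₀ : ℝ) (hc₀ : 0 < c₀)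
    (hquad : ∀ x ∈ U, ∀ y ∈ U, ‖f x - f y - J *ᵥ (x - y)‖ ≤ c₀ * ‖x - y‖ ^ 2) :
    ∃ η : ℝ, 0 < η ∧ ∃ δ : ℝ, 0 < δ ∧ ∃ Γ : ℝ, 0 < Γ ∧
      ∀ x₀ : Fin m → K, ‖x₀ - xs‖ < η →
      ∀ B₀ : Matrix (Fin m) (Fin m) K, ‖B₀ - J‖ < δ →
        (∀ n : ℕ, (broyden f x₀ B₀ n).1 ∈ U ∧ IsUnit (broyden f x₀ B₀ n).2) ∧
        ∀ w : ℕ, ‖(broyden f x₀ B₀ (w + 2 * m)).1 - xs‖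
          ≤ Γ * ‖(broyden f x₀ B₀ w).1 - xs‖ ^ 2 := by
  obtain ⟨ρ, hρ, hρU⟩ := Metric.mem_nhds_iff.1 hU
  -- With this `δ`, the matrix `J⁻¹ B - 1` halves norms as soon as `‖B - J‖ ≤ δ`.
  let δ : ℝ := 1 / (2 * (‖J⁻¹‖ + 1))
  have hδ0 : 0 < δ := by positivity
  have hδ : ‖J⁻¹‖ * δ ≤ 1 / 2 := by
    rw [mul_one_div, div_le_div_iff₀ (by positivity) (by norm_num)]
    linarith
  let η : ℝ := min ρ (δ / c₀)
  have hη0 : 0 < η := lt_min hρ (by positivity)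
  have hη : c₀ * η ≤ δ := by
    calc c₀ * η ≤ c₀ * (δ / c₀) := by gcongr; exact min_le_right _ _
      _ = δ := by field_simp
  have hηU : ∀ x, ‖x - xs‖ < η → x ∈ U := fun x hx =>
    hρU (by rw [mem_ball_iff_norm]; exact hx.trans_le (min_le_left _ _))
  have hquad' : ∀ x y, ‖x - xs‖ < η → ‖y - xs‖ < η →
      ‖f x - f y - J *ᵥ (x - y)‖ ≤ c₀ * ‖x - y‖ ^ 2 :=
    fun x y hx hy => hquad x (hηU x hx) y (hηU y hy)
  let Γ : ℝ := (‖J⁻¹‖ + 1) * c₀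
  have hΓ : 0 < Γ := by positivity
  refine ⟨η, hη0, δ, hδ0, Γ, hΓ, fun x₀ hx₀ B₀ hB₀ => ?_⟩
  have hnear := broyden_near hm hJ hzero hc₀ hδ hη hquad' hx₀ hB₀.le
  have hunit : ∀ n, IsUnit (broyden f x₀ B₀ n).2 :=
    fun n => isUnit_of_norm_sub_le hJ hδ (hnear n).2
  refine ⟨fun n => ⟨hηU _ (hnear n).1, hunit n⟩, fun w => ?_⟩
  have hhalf : ∀ n, ‖(broyden f x₀ B₀ (n + 1)).1 - xs‖ ≤ 1 / 2 * ‖(broyden f x₀ B₀ n).1 - xs‖ :=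
    fun n => (broyden_succ_near hm hJ hzero hc₀ hδ hη hquad' x₀ B₀ n (hnear n).1 (hnear n).2).1
  have hrec := fun n => broyden_succ_of_isUnit f x₀ B₀ n (hunit n)
  let x : ℕ → Fin m → K := fun n => (broyden f x₀ B₀ n).1
  let B : ℕ → Matrix (Fin m) (Fin m) K := fun n => (broyden f x₀ B₀ n).2
  let s : ℕ → Fin m → K := fun n => x (n + 1) - x n
  change ∀ n, ‖x (n + 1) - xs‖ ≤ 1 / 2 * ‖x n - xs‖ at hhalf
  change ∀ n, B n *ᵥ s n = -f (x n) ∧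
    B (n + 1) = B n + Matrix.vecMulVec (f (x (n + 1))) (broydenU (s n)) at hrec
  change ∀ n, ‖x n - xs‖ < η ∧ ‖B n - J‖ ≤ δ at hnear
  change ‖x (w + 2 * m) - xs‖ ≤ Γ * ‖x w - xs‖ ^ 2
  have hanti : Antitone fun n => ‖x n - xs‖ :=
    antitone_nat_of_succ_le fun n => (hhalf n).trans (by linarith [norm_nonneg (x n - xs)])
  -- Errors at least halve, so each increment is exactly as large as the error it corrects.
  have hs : ∀ n, ‖s n‖ = ‖x n - xs‖ := by
    intro n
    have e : s n = (x (n + 1) - xs) - (x n - xs) := (sub_sub_sub_cancel_right _ _ _).symm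
    refine le_antisymm ?_ ?_
    · rw [e]
      exact ultrametric_norm_sub_le (hanti n.le_succ) le_rfl
    · by_contra! hlt
      have h1 : x n - xs = (x (n + 1) - xs) - s n := by rw [e, sub_sub_cancel]
      have h2 : ‖x n - xs‖ ≤ max ‖x (n + 1) - xs‖ ‖s n‖ := by
        conv_lhs => rw [h1]
        exact ultrametric_norm_sub_le (le_max_left _ _) (le_max_right _ _)
      have h3 := hhalf n
      have h4 := norm_nonneg (s n)
      rcases le_max_iff.1 h2 with h | h <;> linarith
  rcases (norm_nonneg (x w - xs)).eq_or_lt with h0 | hpos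
  · have := hanti (Nat.le_add_right w (2 * m))
    simp only [← h0] at this ⊢
    linarith
  let A : ℕ → Matrix (Fin m) (Fin m) K := fun n => J⁻¹ * (B n - J)
  -- The preconditioned Taylor error of a step: what separates it from the linear recursion.
  let r : ℕ → Fin m → K := fun n => J⁻¹ *ᵥ (f (x (n + 1)) - f (x n) - J *ᵥ s n)
  have hdet := (Matrix.isUnit_iff_isUnit_det _).1 hJ
  have hf : ∀ n, J⁻¹ *ᵥ f (x (n + 1)) = r n - A n *ᵥ s n := by
    intro n
    simp only [r, A]
    rw [← Matrix.mulVec_mulVec, ← Matrix.mulVec_sub, Matrix.sub_mulVec, (hrec n).1]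
    congr 1
    abel
  have hr : ∀ n, w ≤ n → ‖r n‖ ≤ Γ * ‖x w - xs‖ ^ 2 := by
    intro n hn
    calc ‖r n‖ ≤ ‖J⁻¹‖ * (c₀ * ‖s n‖ ^ 2) := (norm_mulVec_le_mul _ _).trans (by
          gcongr
          exact hquad' _ _ (hnear _).1 (hnear _).1)
      _ ≤ (‖J⁻¹‖ + 1) * (c₀ * ‖x w - xs‖ ^ 2) := by
          rw [hs]
          have := hanti hn
          gcongr
          linarith
      _ = _ := by ring
  have hA : ∀ n v, A (n + 1) *ᵥ v =
      A n *ᵥ v - (broydenU (s n) ⬝ᵥ v) • (A n *ᵥ s n) + (broydenU (s n) ⬝ᵥ v) • r n := by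
    intro n v
    have e : A (n + 1) *ᵥ v = A n *ᵥ v + (broydenU (s n) ⬝ᵥ v) • (J⁻¹ *ᵥ f (x (n + 1))) := by
      simp only [A]
      rw [(hrec n).2, add_sub_right_comm, mul_add, Matrix.add_mulVec, ← Matrix.mulVec_mulVec v J⁻¹
        (Matrix.vecMulVec _ _), Matrix.vecMulVec_mulVec, op_smul_eq_smul, Matrix.mulVec_smul]
    rw [e, hf]
    module
  have hstep : ∀ n, s (n + 1) + A (n + 1) *ᵥ s (n + 1) - A n *ᵥ s n = -r n := by
    intro n
    have e : s (n + 1) + A (n + 1) *ᵥ s (n + 1) = J⁻¹ *ᵥ (B (n + 1) *ᵥ s (n + 1)) := by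
      simp only [A]
      rw [mul_sub, Matrix.nonsing_inv_mul _ hdet, Matrix.sub_mulVec, Matrix.one_mulVec,
        Matrix.mulVec_mulVec, add_sub_cancel]
    rw [e, (hrec (n + 1)).1, Matrix.mulVec_neg, hf]
    abel
  rw [← hs]
  refine norm_increment_le_of_approx hm (by positivity) (fun n => A (w + n)) (fun n => s (w + n))
    (fun n v => norm_inv_mulVec_sub_le hδ (hnear _).2 v) (fun n v hv => ?_) (fun n => ?_)
    (fun n => ?_)
  · refine ⟨_, norm_broydenU_dotProduct_le_one hm hv, ?_⟩
    rw [← add_assoc, hA, add_sub_cancel_left, norm_smul]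
    exact (mul_le_of_le_one_left (norm_nonneg _) (norm_broydenU_dotProduct_le_one hm hv)).trans
      (hr _ (Nat.le_add_right w n))
  · rw [← add_assoc, hA]
    by_cases h : s (w + n) = 0
    · simp only [h, Matrix.mulVec_zero, dotProduct_zero, zero_smul, sub_zero, add_zero, norm_zero]
      positivity
    · rw [broydenU_dotProduct_self hm h, one_smul, one_smul, sub_self, zero_add]
      exact hr _ (Nat.le_add_right w n)
  · rw [← add_assoc, hstep, norm_neg]
    exact hr _ (Nat.le_add_right w n)
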